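/- For positive integers $m,n$ let $M_n(\mathbb C)$ be the $n\times n$ complex matrices with the Hilbert–Schmidt inner product $\langle A,B\rangle=\operatorname{tr}[A^*B]$, let $M_n^{++}(\mathbb C)$ be the set of positive definite ones, and for a linear map $\Phi:M_m(\mathbb C)\to M_n(\mathbb C)$ let $\Phi^\dagger:M_n(\mathbb C)\to M_m(\mathbb C)$ be its adjoint. The map $\Phi$ is a Schwarz map if $\Phi(K^*K)\ge\Phi(K)^*\Phi(K)$ for all $K\in M_m(\mathbb C)$, and it is semiunital if $\Phi^\dagger(\mathbf 1)=\frac nm\mathbf 1$. Theorem 4.3. (a) For all $s,t>0$ with $s+t\le 1$, all positive integers $m,n$, all $X,Y\in M_n^{++}(\mathbb C)$, all $K\in M_n(\mathbb C)$, and all semiunital Schwarz maps $\Phi:M_m(\mathbb C)\to M_n(\mathbb C)$ such that $\Phi^\dagger(\mathbf 1)\in M_m^{++}(\mathbb C)$, $$\operatorname{tr}\big[\Phi^\dagger(K^*)\,\Phi^\dagger(Y)^{-s}\,\Phi^\dagger(K)\,\Phi^\dagger(X)^{-t}\big]\;\le\;\Big(\frac nm\Big)^{1-(s+t)}\operatorname{tr}\big[K^*Y^{-s}KX^{-t}\big].$$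 (b) (Lieb convexity theorem) For all $s,t\ge 0$ with $s+t\le 1$ and all positive integers $n$, the function $$(X,Y,K)\mapsto \operatorname{tr}\big[K^*Y^{-s}KX^{-t}\big]$$ is jointly convex on $M_n^{++}(\mathbb C)\times M_n^{++}(\mathbb C)\times M_n(\mathbb C)$. -/

import Mathlib

open scoped ComplexOrder MatrixOrder

/-- The adjoint of a linear map between complex matrix algebras with respect to the
Hilbert–Schmidt inner products `⟪A, B⟫ = tr (Aᴴ * B)`.  Its `(i, j)` entry is the
inner product with the image of the matrix unit `E i j`; the defining identity and uniqueness are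
proved below. -/
def hsAdjoint {m n : ℕ} (Φ : Matrix (Fin m) (Fin m) ℂ →ₗ[ℂ] Matrix (Fin n) (Fin n) ℂ) :
    Matrix (Fin n) (Fin n) ℂ →ₗ[ℂ] Matrix (Fin m) (Fin m) ℂ where
  toFun A := Matrix.of fun i j => ((Φ (Matrix.single i j 1)).conjTranspose * A).trace
  map_add' A B := by
    ext i j
    simp [Matrix.mul_add]
  map_smul' c A := by
    ext i j
    simp

/-- The defining identity `⟪Φ B, A⟫ = ⟪B, Φ† A⟫`. -/
theorem trace_conjTranspose_mul_hsAdjoint {m n : ℕ}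
    (Φ : Matrix (Fin m) (Fin m) ℂ →ₗ[ℂ] Matrix (Fin n) (Fin n) ℂ)
    (B : Matrix (Fin m) (Fin m) ℂ) (A : Matrix (Fin n) (Fin n) ℂ) :
    ((Φ B).conjTranspose * A).trace = (B.conjTranspose * hsAdjoint Φ A).trace := by
  have hB : Φ B = ∑ i, ∑ j, B i j • Φ (Matrix.single i j 1) := by
    conv_lhs => rw [Matrix.matrix_eq_sum_single B]
    simp only [map_sum, ← map_smul, Matrix.smul_single, smul_eq_mul, mul_one]
  rw [hB]
  simp only [Matrix.conjTranspose_sum, Matrix.conjTranspose_smul, Finset.sum_mul,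
    Matrix.trace_sum, Matrix.smul_mul, Matrix.trace_smul, smul_eq_mul]
  rw [Finset.sum_comm]
  simp [Matrix.trace, Matrix.mul_apply, hsAdjoint]

/-- The defining identity determines the adjoint. -/
theorem eq_hsAdjoint {m n : ℕ}
    (Φ : Matrix (Fin m) (Fin m) ℂ →ₗ[ℂ] Matrix (Fin n) (Fin n) ℂ)
    (Ψ : Matrix (Fin n) (Fin n) ℂ →ₗ[ℂ] Matrix (Fin m) (Fin m) ℂ)
    (h : ∀ B A, ((Φ B).conjTranspose * A).trace = (B.conjTranspose * Ψ A).trace) :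
    Ψ = hsAdjoint Φ := by
  ext A i j
  simp [hsAdjoint, h, Matrix.trace_single_mul]

/-- A Schwarz map: `Φ (Kᴴ K) ≥ (Φ K)ᴴ (Φ K)` in the Loewner order, for every matrix `K`. -/
def IsSchwarzMap {m n : ℕ}
    (Φ : Matrix (Fin m) (Fin m) ℂ →ₗ[ℂ] Matrix (Fin n) (Fin n) ℂ) : Prop :=
  ∀ K : Matrix (Fin m) (Fin m) ℂ,
    (Φ (K.conjTranspose * K) - (Φ K).conjTranspose * Φ K).PosSemidef

/-- A semiunital map `Φ : M_m(ℂ) → M_n(ℂ)`: `Φ† 1 = (n / m) 1`. -/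
def IsSemiunital {m n : ℕ}
    (Φ : Matrix (Fin m) (Fin m) ℂ →ₗ[ℂ] Matrix (Fin n) (Fin n) ℂ) : Prop :=
  hsAdjoint Φ 1 = ((n : ℂ) / (m : ℂ)) • (1 : Matrix (Fin m) (Fin m) ℂ)

/-! ### Integral representation of products of negative powers. -/

section StieltjesIntegral

open MeasureTheory Set

/-! Left multiplication by `Y` and right multiplication by `X` commute, and in eigenbases `tr (Kᴴ
Y⁻ˢ K X⁻ᵗ)` is a sum of `|k i j|² y i ^ (-s) x j ^ (-t)`. With `r = 1 - s - t`, `a⁻ˢ b⁻ᵗ c⁻ʳ` is a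
positive mixture of the kernels `1 / (α a + β b + γ c)`, so both claims reduce to `⟪K, (α L_Y + β
R_X + γ)⁻¹ K⟫`.

That form is the maximum over `Z` of `2 Re ⟪K, Z⟫ - ⟪Z, (α L_Y + β R_X + γ) Z⟫`, which is affine in
`(X, Y, K)` for fixed `Z`; hence joint convexity (`pencilInvForm_smul_add_smul_le`). For a Schwarz
map, the maximiser `Z` for the images under `Φ†` yields the trial matrix `Φ Z` for the original data
(`IsSchwarzMap.pencilInvForm_le`). Semiunitality turns `γ` into `γ n / m`, so `c = n / m` produces
the power of `n / m`. -/

theorem integrableOn_rpow_mul_one_add_rpow {r q : ℝ} (hr : 0 < r) (hq : r < q) :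
    IntegrableOn (fun u : ℝ => u ^ (r - 1) * (1 + u) ^ (-q)) (Ioi 0) := by
  have hm : Measurable (fun u : ℝ => u ^ (r - 1) * (1 + u) ^ (-q)) := by fun_prop
  rw [← Ioc_union_Ioi_eq_Ioi (zero_le_one' ℝ)]
  refine IntegrableOn.union ?_ ?_
  · have h : IntegrableOn (fun u : ℝ => u ^ (r - 1)) (Ioc 0 1) :=
      (intervalIntegrable_iff_integrableOn_Ioc_of_le zero_le_one).1
        (intervalIntegral.intervalIntegrable_rpow' (by linarith))
    refine Integrable.mono' h hm.aestronglyMeasurable ?_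
    refine ae_restrict_of_forall_mem measurableSet_Ioc fun u hu => ?_
    have h1 : (1 + u) ^ (-q) ≤ 1 :=
      Real.rpow_le_one_of_one_le_of_nonpos (by linarith [hu.1]) (by linarith)
    have h2 : 0 ≤ u ^ (r - 1) := Real.rpow_nonneg hu.1.le _
    have h3 : 0 ≤ (1 + u) ^ (-q) := Real.rpow_nonneg (by linarith [hu.1]) _
    rw [Real.norm_of_nonneg (mul_nonneg h2 h3)]
    exact mul_le_of_le_one_right h2 h1
  · have h : IntegrableOn (fun u : ℝ => u ^ (r - 1 - q)) (Ioi 1) :=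
      integrableOn_Ioi_rpow_of_lt (by linarith) one_pos
    refine Integrable.mono' h hm.aestronglyMeasurable ?_
    refine ae_restrict_of_forall_mem measurableSet_Ioi fun u hu => ?_
    have hu' : (1 : ℝ) < u := hu
    have hu0 : 0 < u := by linarith
    have h1 : (1 + u) ^ (-q) ≤ u ^ (-q) :=
      Real.rpow_le_rpow_of_nonpos hu0 (by linarith) (by linarith)
    have h2 : 0 ≤ u ^ (r - 1) := Real.rpow_nonneg hu0.le _
    have h3 : 0 ≤ (1 + u) ^ (-q) := Real.rpow_nonneg (by linarith) _
    rw [Real.norm_of_nonneg (mul_nonneg h2 h3), sub_eq_add_neg (r - 1), Real.rpow_add hu0]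
    exact mul_le_mul_of_nonneg_left h1 h2

theorem integral_rpow_mul_one_add_rpow_pos {r q : ℝ} (hr : 0 < r) (hq : r < q) :
    0 < ∫ u in Ioi (0 : ℝ), u ^ (r - 1) * (1 + u) ^ (-q) := by
  have hpos : ∀ u ∈ Ioi (0 : ℝ), 0 < u ^ (r - 1) * (1 + u) ^ (-q) := fun u hu =>
    mul_pos (Real.rpow_pos_of_pos hu _) (Real.rpow_pos_of_pos (add_pos one_pos hu) _)
  rw [setIntegral_pos_iff_support_of_nonneg_ae
    (ae_restrict_of_forall_mem measurableSet_Ioi fun u hu => (hpos u hu).le)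
    (integrableOn_rpow_mul_one_add_rpow hr hq)]
  have : (Function.support fun u : ℝ => u ^ (r - 1) * (1 + u) ^ (-q)) ∩ Ioi 0 = Ioi 0 :=
    inter_eq_right.2 fun u hu => (hpos u hu).ne'
  rw [this]
  simp

theorem rpow_mul_add_mul_rpow {r q a b u : ℝ} (ha : 0 < a) (hb : 0 < b) (hu : 0 < u) :
    u ^ (r - 1) * (a + u * b) ^ (-q) = (a ^ (-q) * (b / a) ^ (1 - r)) *
      ((b / a * u) ^ (r - 1) * (1 + b / a * u) ^ (-q)) := by
  have hba : 0 < b / a := div_pos hb ha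
  have h1 : a + u * b = a * (1 + b / a * u) := by field_simp
  rw [h1, Real.mul_rpow ha.le (by positivity), Real.mul_rpow hba.le hu.le,
    show 1 - r = -(r - 1) by ring, Real.rpow_neg hba.le]
  have : (b / a) ^ (r - 1) ≠ 0 := (Real.rpow_pos_of_pos hba _).ne'
  field_simp

theorem integrableOn_rpow_mul_add_mul_rpow {r q a b : ℝ} (hr : 0 < r) (hq : r < q)
    (ha : 0 < a) (hb : 0 < b) :
    IntegrableOn (fun u : ℝ => u ^ (r - 1) * (a + u * b) ^ (-q)) (Ioi 0) := by
  have hba : 0 < b / a := div_pos hb ha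
  have h := (integrableOn_Ioi_comp_mul_left_iff
    (fun u : ℝ => u ^ (r - 1) * (1 + u) ^ (-q)) 0 hba).2
    (by simpa using integrableOn_rpow_mul_one_add_rpow hr hq)
  exact IntegrableOn.congr_fun (Integrable.const_mul h (a ^ (-q) * (b / a) ^ (1 - r)))
    (fun u hu => (rpow_mul_add_mul_rpow ha hb hu).symm) measurableSet_Ioi

theorem integral_rpow_mul_add_mul_rpow {r q a b : ℝ} (ha : 0 < a) (hb : 0 < b) :
    ∫ u in Ioi (0 : ℝ), u ^ (r - 1) * (a + u * b) ^ (-q) =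
      (a ^ (r - q) * b ^ (-r)) * ∫ u in Ioi (0 : ℝ), u ^ (r - 1) * (1 + u) ^ (-q) := by
  have hba : 0 < b / a := div_pos hb ha
  rw [setIntegral_congr_fun measurableSet_Ioi fun u hu => rpow_mul_add_mul_rpow ha hb hu,
    integral_const_mul,
    integral_comp_mul_left_Ioi (fun u : ℝ => u ^ (r - 1) * (1 + u) ^ (-q)) 0 hba, mul_zero,
    smul_eq_mul, ← mul_assoc]
  congr 1
  rw [mul_assoc, ← Real.rpow_neg_one (b / a), ← Real.rpow_add hba, Real.div_rpow hb.le ha.le,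
    show 1 - r + -1 = -r by ring, show r - q = -q - -r by ring, Real.rpow_sub ha]
  ring

/-- Integrating the hypothesis against `u ^ (r - 1)` gives every term the same positive beta
integral, which cancels without being evaluated. -/
theorem sum_rpow_mul_rpow_nonneg {ι : Type*} [Fintype ι] {w a b : ι → ℝ} {r q : ℝ}
    (hr : 0 < r) (hq : r < q) (ha : ∀ i, 0 < a i) (hb : ∀ i, 0 < b i)
    (h : ∀ u : ℝ, 0 < u → 0 ≤ ∑ i, w i * (a i + u * b i) ^ (-q)) :
    0 ≤ ∑ i, w i * (a i ^ (r - q) * b i ^ (-r)) := by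
  have hint : 0 ≤ ∫ u in Ioi (0 : ℝ), ∑ i, w i * (u ^ (r - 1) * (a i + u * b i) ^ (-q)) := by
    refine setIntegral_nonneg measurableSet_Ioi fun u hu => ?_
    have := mul_nonneg (Real.rpow_nonneg (le_of_lt hu) (r - 1)) (h u hu)
    rw [Finset.mul_sum] at this
    simpa only [mul_left_comm] using this
  rw [integral_finsetSum _ fun i _ =>
    (integrableOn_rpow_mul_add_mul_rpow hr hq (ha i) (hb i)).const_mul (w i)] at hint
  simp only [integral_const_mul, integral_rpow_mul_add_mul_rpow (ha _) (hb _)] at hint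
  simp only [← mul_assoc, ← Finset.sum_mul] at hint ⊢
  exact nonneg_of_mul_nonneg_left hint (integral_rpow_mul_one_add_rpow_pos hr hq)

/-- Nonnegativity of a signed sum of the kernels `1 / (α a + β b + γ c)` passes to the weighted
geometric means of `1 / a`, `1 / b`, `1 / c` with positive weights. -/
theorem sum_rpow_mul_rpow_mul_rpow_nonneg_of_pos {ι : Type*} [Fintype ι] {w a b c : ι → ℝ}
    (ha : ∀ i, 0 < a i) (hb : ∀ i, 0 < b i) (hc : ∀ i, 0 < c i)
    (h : ∀ α β γ : ℝ, 0 < α → 0 < β → 0 < γ →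
      0 ≤ ∑ i, w i / (α * a i + β * b i + γ * c i))
    {s t r : ℝ} (hs : 0 < s) (ht : 0 < t) (hr : 0 < r) (hsum : s + t + r = 1) :
    0 ≤ ∑ i, w i * (a i ^ (-s) * b i ^ (-t) * c i ^ (-r)) := by
  -- The kernels with `β = 1` suffice: integrating over `α` gives the power of `a`, then over `γ =
  -- u` those of `b` and `c`.
  have h1 : ∀ u : ℝ, 0 < u → 0 ≤ ∑ i, w i * a i ^ (-s) * (b i + u * c i) ^ (-(1 - s)) := by
    intro u hu
    have := sum_rpow_mul_rpow_nonneg (w := w) (a := fun i => b i + u * c i) (b := a) hs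
      (show s < 1 by linarith) (fun i => add_pos (hb i) (mul_pos hu (hc i))) ha (fun v hv => by
        have := h v 1 u hv one_pos hu
        refine this.trans_eq (Finset.sum_congr rfl fun i _ => ?_)
        rw [Real.rpow_neg_one, div_eq_mul_inv]
        congr 2
        ring)
    refine this.trans_eq (Finset.sum_congr rfl fun i _ => ?_)
    rw [neg_sub]
    ring
  refine (sum_rpow_mul_rpow_nonneg hr (by linarith) hb hc h1).trans_eq
    (Finset.sum_congr rfl fun i _ => ?_)
  rw [show r - (1 - s) = -t by linarith]
  ring

/-- Nonnegativity of a signed sum of the kernels `1 / (α a + β b + γ c)` passes to the weighted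
geometric means of `1 / a`, `1 / b`, `1 / c`. -/
theorem sum_rpow_mul_rpow_mul_rpow_nonneg {ι : Type*} [Fintype ι] {w a b c : ι → ℝ}
    (ha : ∀ i, 0 < a i) (hb : ∀ i, 0 < b i) (hc : ∀ i, 0 < c i)
    (h : ∀ α β γ : ℝ, 0 < α → 0 < β → 0 < γ →
      0 ≤ ∑ i, w i / (α * a i + β * b i + γ * c i))
    {s t r : ℝ} (hs : 0 ≤ s) (ht : 0 ≤ t) (hr : 0 ≤ r) (hsum : s + t + r = 1) :
    0 ≤ ∑ i, w i * (a i ^ (-s) * b i ^ (-t) * c i ^ (-r)) := by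
  -- Moving the exponents towards `(1/3, 1/3, 1/3)` makes them positive and keeps their sum equal to
  -- one; then `ε → 0`.
  let e : ℝ → ℝ → ℝ := fun p ε => (1 - ε) * p + ε / 3
  have hcont : Continuous fun ε : ℝ =>
      ∑ i, w i * (a i ^ (-e s ε) * b i ^ (-e t ε) * c i ^ (-e r ε)) := by
    refine continuous_finsetSum _ fun i _ => continuous_const.mul ?_
    have key : ∀ {x p : ℝ}, 0 < x → Continuous fun ε : ℝ => x ^ (-e p ε) := fun hx =>
      continuous_const.rpow (by fun_prop) fun _ => Or.inl hx.ne'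
    exact ((key (ha i)).mul (key (hb i))).mul (key (hc i))
  have hlim := (hcont.tendsto 0).mono_left (nhdsWithin_le_nhds (s := Ioi 0))
  simp only [e, sub_zero, one_mul, zero_div, add_zero] at hlim
  refine ge_of_tendsto hlim ?_
  filter_upwards [Ioo_mem_nhdsGT (zero_lt_one' ℝ)] with ε hε
  have hpos : ∀ {p : ℝ}, 0 ≤ p → 0 < (1 - ε) * p + ε / 3 := fun hp =>
    add_pos_of_nonneg_of_pos (mul_nonneg (by linarith [hε.2]) hp) (by linarith [hε.1])
  exact sum_rpow_mul_rpow_mul_rpow_nonneg_of_pos ha hb hc h (hpos hs) (hpos ht) (hpos hr)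
    (by linear_combination (1 - ε) * hsum)

end StieltjesIntegral
-- Spectral expansion, variational formula and joint convexity.
section SpectralExpansion

open Matrix

variable {n : Type*} [Fintype n] [DecidableEq n] {X Y : Matrix n n ℂ}

/-- The entries of `K` with respect to eigenbases of the Hermitian matrices `Y` (rows) and
`X` (columns). -/
noncomputable def spectralCoeff (hX : X.IsHermitian) (hY : Y.IsHermitian) (K : Matrix n n ℂ) :
    Matrix n n ℂ :=
  (hY.eigenvectorUnitary : Matrix n n ℂ)ᴴ * K * (hX.eigenvectorUnitary : Matrix n n ℂ)

theorem trace_conjTranspose_mul_cfc_mul_cfc (hX : X.IsHermitian) (hY : Y.IsHermitian)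
    (f g : ℝ → ℝ) (K Z : Matrix n n ℂ) :
    (Kᴴ * cfc f Y * Z * cfc g X).trace = ∑ p : n × n,
      star (spectralCoeff hX hY K p.1 p.2) * spectralCoeff hX hY Z p.1 p.2 *
        ((f (hY.eigenvalues p.1) * g (hX.eigenvalues p.2) : ℝ) : ℂ) := by
  have h : (Kᴴ * cfc f Y * Z * cfc g X).trace =
      ((spectralCoeff hX hY K)ᴴ * diagonal (fun i => (f (hY.eigenvalues i) : ℂ)) *
        spectralCoeff hX hY Z * diagonal (fun i => (g (hX.eigenvalues i) : ℂ))).trace := by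
    rw [hX.cfc_eq, hY.cfc_eq, IsHermitian.cfc, IsHermitian.cfc, Unitary.conjStarAlgAut_apply,
      Unitary.conjStarAlgAut_apply]
    simp only [spectralCoeff, conjTranspose_mul, conjTranspose_conjTranspose, ← mul_assoc]
    rw [trace_mul_comm]
    simp only [← mul_assoc, star_eq_conjTranspose]
    rfl
  rw [h, Fintype.sum_prod_type, Finset.sum_comm, trace]
  refine Finset.sum_congr rfl fun j _ => ?_
  rw [diag_apply, mul_diagonal, mul_apply, Finset.sum_mul]
  refine Finset.sum_congr rfl fun i _ => ?_
  rw [mul_diagonal, conjTranspose_apply]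
  push_cast
  ring

theorem trace_conjTranspose_mul_rpow_mul_rpow (hX : X.PosDef) (hY : Y.PosDef) (s t : ℝ)
    (K : Matrix n n ℂ) :
    (Kᴴ * Y ^ (-s) * K * X ^ (-t)).trace = ((∑ p : n × n,
      ‖spectralCoeff hX.1 hY.1 K p.1 p.2‖ ^ 2 *
        (hY.1.eigenvalues p.1 ^ (-s) * hX.1.eigenvalues p.2 ^ (-t)) : ℝ) : ℂ) := by
  rw [CFC.rpow_eq_cfc_real hX.posSemidef.nonneg, CFC.rpow_eq_cfc_real hY.posSemidef.nonneg,
    trace_conjTranspose_mul_cfc_mul_cfc hX.1 hY.1, Complex.ofReal_sum]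
  refine Finset.sum_congr rfl fun p _ => ?_
  rw [Complex.ofReal_mul (‖_‖ ^ 2), Complex.ofReal_pow, ← Complex.conj_mul']
  rfl

/-- The quadratic form `⟪Z, (α L_Y + β R_X + γ) Z⟫` of a combination of the left and right
multiplications by `Y` and `X`. -/
noncomputable def pencilForm (α β γ : ℝ) (X Y Z : Matrix n n ℂ) : ℝ :=
  α * (Zᴴ * Y * Z).trace.re + β * (Zᴴ * Z * X).trace.re + γ * (Zᴴ * Z).trace.re

/-- The quadratic form `⟪K, (α L_Y + β R_X + γ)⁻¹ K⟫`. -/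
noncomputable def pencilInvForm (α β γ : ℝ) (hX : X.IsHermitian) (hY : Y.IsHermitian)
    (K : Matrix n n ℂ) : ℝ :=
  ∑ p : n × n, ‖spectralCoeff hX hY K p.1 p.2‖ ^ 2 /
    (α * hY.eigenvalues p.1 + β * hX.eigenvalues p.2 + γ)

theorem re_trace_conjTranspose_mul_eq_sum (hX : X.IsHermitian) (hY : Y.IsHermitian)
    (K Z : Matrix n n ℂ) :
    (Kᴴ * Z).trace.re = ∑ p : n × n,
      (star (spectralCoeff hX hY K p.1 p.2) * spectralCoeff hX hY Z p.1 p.2).re := by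
  have h := trace_conjTranspose_mul_cfc_mul_cfc hX hY (fun _ => 1) (fun _ => 1) K Z
  rw [cfc_const_one ℝ X hX.isSelfAdjoint, cfc_const_one ℝ Y hY.isSelfAdjoint] at h
  simpa using congrArg Complex.re h

theorem pencilForm_eq_sum (hX : X.IsHermitian) (hY : Y.IsHermitian) (α β γ : ℝ)
    (Z : Matrix n n ℂ) :
    pencilForm α β γ X Y Z = ∑ p : n × n,
      (α * hY.eigenvalues p.1 + β * hX.eigenvalues p.2 + γ) *
        ‖spectralCoeff hX hY Z p.1 p.2‖ ^ 2 := by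
  have expand : ∀ f g : ℝ → ℝ, (Zᴴ * cfc f Y * Z * cfc g X).trace.re = ∑ p : n × n,
      f (hY.eigenvalues p.1) * g (hX.eigenvalues p.2) *
        ‖spectralCoeff hX hY Z p.1 p.2‖ ^ 2 := by
    intro f g
    rw [trace_conjTranspose_mul_cfc_mul_cfc hX hY, Complex.re_sum]
    refine Finset.sum_congr rfl fun p _ => ?_
    rw [Complex.star_def, Complex.conj_mul', ← Complex.ofReal_pow, ← Complex.ofReal_mul,
      Complex.ofReal_re, mul_comm]
  have h1 := expand id (fun _ => 1)
  have h2 := expand (fun _ => 1) id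
  have h3 := expand (fun _ => 1) (fun _ => 1)
  rw [cfc_id ℝ Y hY.isSelfAdjoint, cfc_const_one ℝ X hX.isSelfAdjoint, mul_one] at h1
  rw [cfc_id ℝ X hX.isSelfAdjoint, cfc_const_one ℝ Y hY.isSelfAdjoint, mul_one] at h2
  rw [cfc_const_one ℝ X hX.isSelfAdjoint, cfc_const_one ℝ Y hY.isSelfAdjoint, mul_one,
    mul_one] at h3
  rw [pencilForm, h1, h2, h3, Finset.mul_sum, Finset.mul_sum, Finset.mul_sum,
    ← Finset.sum_add_distrib, ← Finset.sum_add_distrib]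
  refine Finset.sum_congr rfl fun p _ => ?_
  simp only [id]
  ring

/-- Completing the square: `|k - d z|² ≥ 0`, with equality at `z = k / d`. -/
theorem two_mul_re_star_mul_sub_le {d : ℝ} (hd : 0 < d) (k z : ℂ) :
    2 * (star k * z).re - d * ‖z‖ ^ 2 ≤ ‖k‖ ^ 2 / d := by
  rw [le_div_iff₀ hd, Complex.sq_norm, Complex.sq_norm, Complex.normSq_apply,
    Complex.normSq_apply]
  simp only [Complex.star_def, Complex.mul_re, Complex.conj_re, Complex.conj_im]
  nlinarith [sq_nonneg (k.re - d * z.re), sq_nonneg (k.im - d * z.im)]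

theorem two_mul_re_star_mul_div_sub {d : ℝ} (hd : 0 < d) (k : ℂ) :
    2 * (star k * (k / d)).re - d * ‖k / d‖ ^ 2 = ‖k‖ ^ 2 / d := by
  rw [← mul_div_assoc, Complex.star_def, Complex.conj_mul', norm_div, Complex.norm_real,
    Real.norm_of_nonneg hd.le, ← Complex.ofReal_pow, ← Complex.ofReal_div, Complex.ofReal_re]
  field_simp
  ring

theorem pencil_eigenvalue_pos (hX : X.PosDef) (hY : Y.PosDef) {α β γ : ℝ} (hα : 0 < α)
    (hβ : 0 < β) (hγ : 0 < γ) (i j : n) :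
    0 < α * hY.1.eigenvalues i + β * hX.1.eigenvalues j + γ :=
  add_pos (add_pos (mul_pos hα (hY.eigenvalues_pos i)) (mul_pos hβ (hX.eigenvalues_pos j))) hγ

theorem two_mul_re_trace_sub_pencilForm_le (hX : X.PosDef) (hY : Y.PosDef) {α β γ : ℝ}
    (hα : 0 < α) (hβ : 0 < β) (hγ : 0 < γ) (K Z : Matrix n n ℂ) :
    2 * (Kᴴ * Z).trace.re - pencilForm α β γ X Y Z ≤ pencilInvForm α β γ hX.1 hY.1 K := by
  rw [re_trace_conjTranspose_mul_eq_sum hX.1 hY.1, pencilForm_eq_sum hX.1 hY.1, pencilInvForm,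
    Finset.mul_sum, ← Finset.sum_sub_distrib]
  exact Finset.sum_le_sum fun p _ =>
    two_mul_re_star_mul_sub_le (pencil_eigenvalue_pos hX hY hα hβ hγ _ _) _ _

theorem exists_two_mul_re_trace_sub_pencilForm_eq (hX : X.PosDef) (hY : Y.PosDef) {α β γ : ℝ}
    (hα : 0 < α) (hβ : 0 < β) (hγ : 0 < γ) (K : Matrix n n ℂ) :
    ∃ Z, 2 * (Kᴴ * Z).trace.re - pencilForm α β γ X Y Z = pencilInvForm α β γ hX.1 hY.1 K := by
  -- In eigenbases, the maximiser `(α L_Y + β R_X + γ)⁻¹ K`.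
  let z : Matrix n n ℂ := of fun i j => spectralCoeff hX.1 hY.1 K i j /
    ((α * hY.1.eigenvalues i + β * hX.1.eigenvalues j + γ : ℝ) : ℂ)
  refine ⟨(hY.1.eigenvectorUnitary : Matrix n n ℂ) * z *
    (hX.1.eigenvectorUnitary : Matrix n n ℂ)ᴴ, ?_⟩
  have hz : spectralCoeff hX.1 hY.1 ((hY.1.eigenvectorUnitary : Matrix n n ℂ) * z *
      (hX.1.eigenvectorUnitary : Matrix n n ℂ)ᴴ) = z := by
    have h1 : (hY.1.eigenvectorUnitary : Matrix n n ℂ)ᴴ * hY.1.eigenvectorUnitary = 1 :=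
      Unitary.coe_star_mul_self _
    have h2 : (hX.1.eigenvectorUnitary : Matrix n n ℂ)ᴴ * hX.1.eigenvectorUnitary = 1 :=
      Unitary.coe_star_mul_self _
    rw [spectralCoeff, mul_assoc _ z, ← mul_assoc, h1, one_mul, mul_assoc, h2, mul_one]
  rw [re_trace_conjTranspose_mul_eq_sum hX.1 hY.1, pencilForm_eq_sum hX.1 hY.1, pencilInvForm,
    Finset.mul_sum, ← Finset.sum_sub_distrib, hz]
  exact Finset.sum_congr rfl fun p _ =>
    two_mul_re_star_mul_div_sub (pencil_eigenvalue_pos hX hY hα hβ hγ _ _) _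

theorem pencilForm_smul_add_smul (α β γ a b : ℝ) (hab : a + b = 1) (X₁ Y₁ X₂ Y₂ Z : Matrix n n ℂ) :
    pencilForm α β γ (a • X₁ + b • X₂) (a • Y₁ + b • Y₂) Z =
      a * pencilForm α β γ X₁ Y₁ Z + b * pencilForm α β γ X₂ Y₂ Z := by
  simp only [pencilForm, mul_add, add_mul, Matrix.mul_smul, Matrix.smul_mul, trace_add,
    trace_smul, Complex.add_re, Complex.real_smul, Complex.re_ofReal_mul]
  linear_combination γ * (Zᴴ * Z).trace.re * (-hab)

/-- Joint convexity of `(X, Y, K) ↦ ⟪K, (α L_Y + β R_X + γ)⁻¹ K⟫`. -/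
theorem pencilInvForm_smul_add_smul_le {X₁ Y₁ X₂ Y₂ : Matrix n n ℂ} (hX₁ : X₁.PosDef)
    (hY₁ : Y₁.PosDef) (hX₂ : X₂.PosDef) (hY₂ : Y₂.PosDef) {α β γ a b : ℝ}
    (hα : 0 < α) (hβ : 0 < β) (hγ : 0 < γ) (ha : 0 ≤ a) (hb : 0 ≤ b) (hab : a + b = 1)
    (hX : (a • X₁ + b • X₂).PosDef) (hY : (a • Y₁ + b • Y₂).PosDef) (K₁ K₂ : Matrix n n ℂ) :
    pencilInvForm α β γ hX.1 hY.1 (a • K₁ + b • K₂) ≤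
      a * pencilInvForm α β γ hX₁.1 hY₁.1 K₁ + b * pencilInvForm α β γ hX₂.1 hY₂.1 K₂ := by
  -- The maximiser at the convex combination serves as trial matrix at both endpoints.
  obtain ⟨Z, hZ⟩ := exists_two_mul_re_trace_sub_pencilForm_eq hX hY hα hβ hγ (a • K₁ + b • K₂)
  have h1 := mul_le_mul_of_nonneg_left
    (two_mul_re_trace_sub_pencilForm_le hX₁ hY₁ hα hβ hγ K₁ Z) ha
  have h2 := mul_le_mul_of_nonneg_left
    (two_mul_re_trace_sub_pencilForm_le hX₂ hY₂ hα hβ hγ K₂ Z) hb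
  have h3 : ((a • K₁ + b • K₂)ᴴ * Z).trace.re =
      a * (K₁ᴴ * Z).trace.re + b * (K₂ᴴ * Z).trace.re := by
    simp [add_mul]
  rw [← hZ, h3, pencilForm_smul_add_smul α β γ a b hab]
  linarith

omit [Fintype n] [DecidableEq n] in
theorem Matrix.PosDef.real_smul_add_smul {A B : Matrix n n ℂ} (hA : A.PosDef) (hB : B.PosDef)
    {a b : ℝ} (ha : 0 ≤ a) (hb : 0 ≤ b) (hab : a + b = 1) : (a • A + b • B).PosDef := by
  rcases ha.eq_or_lt with rfl | ha
  · obtain rfl : b = 1 := by linarith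
    simpa using hB
  · exact (hA.smul ha).add_posSemidef (hB.posSemidef.smul hb)

/-- Lieb's convexity theorem. -/
theorem convexOn_trace_conjTranspose_mul_rpow_mul_rpow {s t : ℝ} (hs : 0 ≤ s) (ht : 0 ≤ t)
    (hst : s + t ≤ 1) :
    ConvexOn ℝ {p : Matrix n n ℂ × Matrix n n ℂ × Matrix n n ℂ | p.1.PosDef ∧ p.2.1.PosDef}
      (fun p => (p.2.2ᴴ * p.2.1 ^ (-s) * p.2.2 * p.1 ^ (-t)).trace) := by
  refine ⟨fun p hp q hq a b ha hb hab => ⟨hp.1.real_smul_add_smul hq.1 ha hb hab,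
    hp.2.real_smul_add_smul hq.2 ha hb hab⟩, ?_⟩
  rintro ⟨X₁, Y₁, K₁⟩ ⟨hX₁, hY₁⟩ ⟨X₂, Y₂, K₂⟩ ⟨hX₂, hY₂⟩ a b ha hb hab
  dsimp only at hX₁ hY₁ hX₂ hY₂
  have hX := hX₁.real_smul_add_smul hX₂ ha hb hab
  have hY := hY₁.real_smul_add_smul hY₂ ha hb hab
  simp only [Prod.smul_mk, Prod.mk_add_mk]
  rw [trace_conjTranspose_mul_rpow_mul_rpow hX hY, trace_conjTranspose_mul_rpow_mul_rpow hX₁ hY₁,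
    trace_conjTranspose_mul_rpow_mul_rpow hX₂ hY₂, Complex.real_smul, Complex.real_smul]
  norm_cast
  -- The convexity defect is one signed sum over three sets of eigenvalue pairs; `c = 1` hides the
  -- third exponent.
  have key := sum_rpow_mul_rpow_mul_rpow_nonneg (ι := (n × n) ⊕ (n × n) ⊕ (n × n))
    (w := Sum.elim (fun p => -‖spectralCoeff hX.1 hY.1 (a • K₁ + b • K₂) p.1 p.2‖ ^ 2)
      (Sum.elim (fun p => a * ‖spectralCoeff hX₁.1 hY₁.1 K₁ p.1 p.2‖ ^ 2)
        (fun p => b * ‖spectralCoeff hX₂.1 hY₂.1 K₂ p.1 p.2‖ ^ 2)))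
    (a := Sum.elim (fun p => hY.1.eigenvalues p.1)
      (Sum.elim (fun p => hY₁.1.eigenvalues p.1) (fun p => hY₂.1.eigenvalues p.1)))
    (b := Sum.elim (fun p => hX.1.eigenvalues p.2)
      (Sum.elim (fun p => hX₁.1.eigenvalues p.2) (fun p => hX₂.1.eigenvalues p.2)))
    (c := fun _ => 1)
    (by rintro (p | p | p) <;> exact PosDef.eigenvalues_pos (by assumption) _)
    (by rintro (p | p | p) <;> exact PosDef.eigenvalues_pos (by assumption) _)
    (fun _ => one_pos)
    (fun α β γ hα hβ hγ => by
      have := pencilInvForm_smul_add_smul_le hX₁ hY₁ hX₂ hY₂ hα hβ hγ ha hb hab hX hY K₁ K₂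
      simp only [pencilInvForm, Finset.mul_sum] at this
      simp only [Fintype.sum_sum_type, Sum.elim_inl, Sum.elim_inr, mul_one, neg_div,
        mul_div_assoc, Finset.sum_neg_distrib]
      linarith)
    hs ht (sub_nonneg.2 hst) (by ring)
  simp only [Fintype.sum_sum_type, Sum.elim_inl, Sum.elim_inr, Real.one_rpow, mul_one, neg_mul,
    Finset.sum_neg_distrib, mul_assoc a, mul_assoc b] at key
  simp only [Finset.mul_sum]
  linarith

end SpectralExpansion

/-! ### Schwarz maps and monotonicity. -/

section SchwarzMap

open Matrix

variable {m n : ℕ} {Φ : Matrix (Fin m) (Fin m) ℂ →ₗ[ℂ] Matrix (Fin n) (Fin n) ℂ}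

theorem IsSchwarzMap.map_conjTranspose_mul_self (hΦ : IsSchwarzMap Φ)
    (K : Matrix (Fin m) (Fin m) ℂ) : (Φ (Kᴴ * K)).PosSemidef := by
  simpa using (hΦ K).add (posSemidef_conjTranspose_mul_self (Φ K))

theorem IsSchwarzMap.map_isHermitian (hΦ : IsSchwarzMap Φ) {H : Matrix (Fin m) (Fin m) ℂ}
    (hH : H.IsHermitian) : (Φ H).IsHermitian := by
  -- Polarisation: `H` is a real combination of matrices `Kᴴ * K`, whose images are Hermitian.
  have h : H = (2⁻¹ : ℂ) • ((H + 1)ᴴ * (H + 1) - Hᴴ * H - 1ᴴ * 1) := by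
    rw [conjTranspose_add, conjTranspose_one, hH.eq]
    simp only [mul_add, add_mul, mul_one, one_mul]
    module
  rw [h, map_smul, map_sub, map_sub, IsHermitian, conjTranspose_smul,
    (((hΦ.map_conjTranspose_mul_self _).1.sub (hΦ.map_conjTranspose_mul_self _).1).sub
      (hΦ.map_conjTranspose_mul_self _).1).eq]
  simp

theorem IsSchwarzMap.map_conjTranspose (hΦ : IsSchwarzMap Φ) (K : Matrix (Fin m) (Fin m) ℂ) :
    Φ Kᴴ = (Φ K)ᴴ := by
  have h1 := hΦ.map_isHermitian (H := realPart K) (realPart K).2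
  have h2 := hΦ.map_isHermitian (H := imaginaryPart K) (imaginaryPart K).2
  rw [← star_eq_conjTranspose, ← star_eq_conjTranspose]
  conv_lhs => rw [← realPart_add_I_smul_imaginaryPart K]
  conv_rhs => rw [← realPart_add_I_smul_imaginaryPart K]
  simp only [star_add, star_smul, map_add, map_smul, (realPart K).2.star_eq,
    (imaginaryPart K).2.star_eq]
  simp only [star_eq_conjTranspose, h1.eq, h2.eq]

theorem IsSchwarzMap.hsAdjoint_conjTranspose (hΦ : IsSchwarzMap Φ)
    (A : Matrix (Fin n) (Fin n) ℂ) : hsAdjoint Φ Aᴴ = (hsAdjoint Φ A)ᴴ := by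
  ext i j
  simp only [hsAdjoint, LinearMap.coe_mk, AddHom.coe_mk, of_apply, conjTranspose_apply]
  rw [← trace_conjTranspose, conjTranspose_mul, conjTranspose_conjTranspose,
    ← hΦ.map_conjTranspose, conjTranspose_single, star_one, trace_mul_comm]

/-- With `P = Qᴴ * Q` and `q` the entries of `Q` in an eigenbasis of `X`, `tr P = ∑ |q i j|²` and
`tr (P X) = ∑ x j |q i j|²`; a nonzero `q i j` makes both positive. -/
theorem Matrix.PosSemidef.trace_mul_pos {P X : Matrix (Fin n) (Fin n) ℂ} (hP : P.PosSemidef)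
    (hP' : 0 < P.trace) (hX : X.PosDef) : 0 < (P * X).trace := by
  obtain ⟨Q, rfl⟩ := CStarAlgebra.nonneg_iff_eq_star_mul_self.1 hP.nonneg
  have hQ := pencilForm_eq_sum hX.1 hX.1 0 0 1 Q
  have hQX := pencilForm_eq_sum hX.1 hX.1 0 1 0 Q
  simp only [star_eq_conjTranspose] at hP hP' ⊢
  simp only [pencilForm, zero_mul, one_mul, zero_add, add_zero] at hQ hQX
  have hnonneg : 0 ≤ (Qᴴ * Q * X).trace := by
    rw [mul_assoc, trace_mul_comm]
    exact (hX.posSemidef.mul_mul_conjTranspose_same Q).trace_nonneg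
  refine Complex.pos_iff.2 ⟨?_, (Complex.nonneg_iff.1 hnonneg).2⟩
  obtain ⟨p, hp, hp'⟩ := Finset.exists_ne_zero_of_sum_ne_zero
    (hQ ▸ (Complex.pos_iff.1 hP').1.ne')
  rw [hQX]
  exact Finset.sum_pos' (fun q _ => mul_nonneg (hX.eigenvalues_pos _).le (sq_nonneg _))
    ⟨p, hp, mul_pos (hX.eigenvalues_pos _) (lt_of_le_of_ne (sq_nonneg _) hp'.symm)⟩

/-- `⟪v, Φ†(A) v⟫ = tr (Φ(v vᴴ) A)`; the case `A = 1` shows that the positive semidefinite `Φ(v vᴴ)`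
has positive trace. -/
theorem IsSchwarzMap.hsAdjoint_posDef (hΦ : IsSchwarzMap Φ) (h1 : (hsAdjoint Φ 1).PosDef)
    {X : Matrix (Fin n) (Fin n) ℂ} (hX : X.PosDef) : (hsAdjoint Φ X).PosDef := by
  have hvec : ∀ (v : Fin m → ℂ) (A : Matrix (Fin n) (Fin n) ℂ),
      star v ⬝ᵥ hsAdjoint Φ A *ᵥ v = (Φ (vecMulVec v (star v)) * A).trace := by
    intro v A
    have h := trace_conjTranspose_mul_hsAdjoint Φ (vecMulVec v (star v)) A
    rw [(hΦ.map_isHermitian (posSemidef_vecMulVec_self_star v).1).eq,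
      (posSemidef_vecMulVec_self_star v).1.eq, vecMulVec_mul, trace_vecMulVec,
      dotProduct_comm, ← dotProduct_mulVec] at h
    exact h.symm
  have hherm : (hsAdjoint Φ X).IsHermitian := by
    rw [IsHermitian, ← hΦ.hsAdjoint_conjTranspose, hX.1.eq]
  refine PosDef.of_dotProduct_mulVec_pos hherm fun v hv => ?_
  have := h1.dotProduct_mulVec_pos hv
  rw [hvec, mul_one] at this
  rw [hvec]
  refine PosSemidef.trace_mul_pos ?_ this hX
  obtain ⟨Q, hQ⟩ := CStarAlgebra.nonneg_iff_eq_star_mul_self.1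
    (posSemidef_vecMulVec_self_star v).nonneg
  exact hQ ▸ hΦ.map_conjTranspose_mul_self Q

theorem IsSchwarzMap.re_trace_map_mul_le (hΦ : IsSchwarzMap Φ) {X : Matrix (Fin n) (Fin n) ℂ}
    (hX : X.PosSemidef) (Z : Matrix (Fin m) (Fin m) ℂ) :
    ((Φ Z)ᴴ * Φ Z * X).trace.re ≤ (Zᴴ * Z * hsAdjoint Φ X).trace.re := by
  obtain ⟨Q, rfl⟩ := CStarAlgebra.nonneg_iff_eq_star_mul_self.1 hX.nonneg
  rw [star_eq_conjTranspose]
  have h := trace_conjTranspose_mul_hsAdjoint Φ (Zᴴ * Z) (Qᴴ * Q)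
  rw [(isHermitian_conjTranspose_mul_self Z).eq,
    (hΦ.map_conjTranspose_mul_self Z).1.eq] at h
  have h' := ((hΦ Z).mul_mul_conjTranspose_same Q).trace_nonneg
  rw [trace_mul_comm, ← mul_assoc, trace_mul_comm, sub_mul, trace_sub, sub_nonneg] at h'
  exact h ▸ (Complex.le_def.1 h').1

theorem IsSchwarzMap.pencilForm_le (hΦ : IsSchwarzMap Φ) (hΦ' : IsSemiunital Φ)
    {X Y : Matrix (Fin n) (Fin n) ℂ} (hX : X.PosSemidef) (hY : Y.PosSemidef) {α β γ : ℝ}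
    (hα : 0 ≤ α) (hβ : 0 ≤ β) (hγ : 0 ≤ γ) (Z : Matrix (Fin m) (Fin m) ℂ) :
    pencilForm α β γ X Y (Φ Z) ≤
      pencilForm α β (γ * (n / m)) (hsAdjoint Φ X) (hsAdjoint Φ Y) Z := by
  have h1 := hΦ.re_trace_map_mul_le hX Z
  -- The left multiplication term needs the Schwarz inequality at `Zᴴ`, since there `Y` is paired
  -- with `Z * Zᴴ`.
  have h2 := hΦ.re_trace_map_mul_le hY Zᴴ
  have h3 := hΦ.re_trace_map_mul_le PosSemidef.one Z
  rw [hΦ.map_conjTranspose, conjTranspose_conjTranspose, conjTranspose_conjTranspose,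
    mul_assoc, trace_mul_comm, mul_assoc Z, trace_mul_comm Z] at h2
  have h4 : (Zᴴ * Z * hsAdjoint Φ 1).trace.re = n / m * (Zᴴ * Z).trace.re := by
    rw [hΦ', Matrix.mul_smul, mul_one, trace_smul, smul_eq_mul]
    rw [show ((n : ℂ) / m) = ((n / m : ℝ) : ℂ) by push_cast; rfl, Complex.re_ofReal_mul]
  rw [mul_one, h4] at h3
  simp only [pencilForm, mul_assoc γ]
  gcongr

theorem IsSchwarzMap.pencilInvForm_le (hΦ : IsSchwarzMap Φ) (hΦ' : IsSemiunital Φ)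
    {X Y : Matrix (Fin n) (Fin n) ℂ} (hX : X.PosDef) (hY : Y.PosDef)
    (hX' : (hsAdjoint Φ X).PosDef) (hY' : (hsAdjoint Φ Y).PosDef) {α β γ : ℝ}
    (hα : 0 < α) (hβ : 0 < β) (hγ : 0 < γ) (hmn : (0 : ℝ) < n / m)
    (K : Matrix (Fin n) (Fin n) ℂ) :
    pencilInvForm α β (γ * (n / m)) hX'.1 hY'.1 (hsAdjoint Φ K) ≤
      pencilInvForm α β γ hX.1 hY.1 K := by
  obtain ⟨Z, hZ⟩ := exists_two_mul_re_trace_sub_pencilForm_eq hX' hY' hα hβ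
    (mul_pos hγ hmn) (hsAdjoint Φ K)
  have h1 := two_mul_re_trace_sub_pencilForm_le hX hY hα hβ hγ K (Φ Z)
  have h2 := hΦ.pencilForm_le hΦ' hX.posSemidef hY.posSemidef hα.le hβ.le hγ.le Z
  have h3 : ((hsAdjoint Φ K)ᴴ * Z).trace.re = (Kᴴ * Φ Z).trace.re := by
    rw [← hΦ.hsAdjoint_conjTranspose, trace_mul_comm, trace_mul_comm Kᴴ]
    have := trace_conjTranspose_mul_hsAdjoint Φ Zᴴ Kᴴ
    rw [hΦ.map_conjTranspose, conjTranspose_conjTranspose, conjTranspose_conjTranspose] at this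
    rw [this]
  rw [← hZ, h3]
  linarith

/-- Monotonicity of `tr (Kᴴ Y⁻ˢ K X⁻ᵗ)` under the adjoint of a semiunital Schwarz map. -/
theorem IsSchwarzMap.trace_hsAdjoint_rpow_le (hΦ : IsSchwarzMap Φ) (hΦ' : IsSemiunital Φ)
    (hm : 0 < m) (hn : 0 < n) (h1 : (hsAdjoint Φ 1).PosDef)
    {X Y : Matrix (Fin n) (Fin n) ℂ} (hX : X.PosDef) (hY : Y.PosDef)
    (K : Matrix (Fin n) (Fin n) ℂ) {s t : ℝ} (hs : 0 ≤ s) (ht : 0 ≤ t) (hst : s + t ≤ 1) :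
    (hsAdjoint Φ Kᴴ * (hsAdjoint Φ Y) ^ (-s) * hsAdjoint Φ K * (hsAdjoint Φ X) ^ (-t)).trace ≤
      ((((n : ℝ) / (m : ℝ)) ^ (1 - (s + t)) : ℝ) : ℂ) *
        (Kᴴ * Y ^ (-s) * K * X ^ (-t)).trace := by
  have hX' := hΦ.hsAdjoint_posDef h1 hX
  have hY' := hΦ.hsAdjoint_posDef h1 hY
  have hmn : (0 : ℝ) < n / m := by positivity
  rw [hΦ.hsAdjoint_conjTranspose, trace_conjTranspose_mul_rpow_mul_rpow hX hY,
    trace_conjTranspose_mul_rpow_mul_rpow hX' hY']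
  norm_cast
  have key := sum_rpow_mul_rpow_mul_rpow_nonneg
    (ι := (Fin n × Fin n) ⊕ (Fin m × Fin m))
    (w := Sum.elim (fun p => ‖spectralCoeff hX.1 hY.1 K p.1 p.2‖ ^ 2)
      (fun p => -‖spectralCoeff hX'.1 hY'.1 (hsAdjoint Φ K) p.1 p.2‖ ^ 2))
    (a := Sum.elim (fun p => hY.1.eigenvalues p.1) (fun p => hY'.1.eigenvalues p.1))
    (b := Sum.elim (fun p => hX.1.eigenvalues p.2) (fun p => hX'.1.eigenvalues p.2))
    (c := Sum.elim (fun _ => 1) (fun _ => (n : ℝ) / m))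
    (by rintro (p | p) <;> exact PosDef.eigenvalues_pos (by assumption) _)
    (by rintro (p | p) <;> exact PosDef.eigenvalues_pos (by assumption) _)
    (by rintro (p | p) <;> simp only [Sum.elim_inl, Sum.elim_inr, one_pos, hmn])
    (fun α β γ hα hβ hγ => by
      have := hΦ.pencilInvForm_le hΦ' hX hY hX' hY' hα hβ hγ hmn K
      simp only [pencilInvForm] at this
      simp only [Fintype.sum_sum_type, Sum.elim_inl, Sum.elim_inr, mul_one, neg_div,
        Finset.sum_neg_distrib]
      linarith)
    hs ht (sub_nonneg.2 hst) (by ring)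
  simp only [Fintype.sum_sum_type, Sum.elim_inl, Sum.elim_inr, Real.one_rpow, mul_one, neg_mul,
    Finset.sum_neg_distrib, ← mul_assoc, ← Finset.sum_mul] at key ⊢
  -- The factor `(n / m) ^ (-(1 - (s + t)))` from `c = n / m` moves to the other side.
  rw [Real.rpow_neg hmn.le, ← sub_eq_add_neg, sub_nonneg,
    mul_inv_le_iff₀ (Real.rpow_pos_of_pos hmn _), mul_comm] at key
  exact key

end SchwarzMap

/-- Inequalities between traces are in the partial order of `ℂ`, where `z ≤ w` means
`z.re ≤ w.re` and `z.im = w.im`.  Real powers of matrices are those of the continuous functional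
calculus. -/
theorem theorem4p3 :
    (∀ (s t : ℝ), 0 < s → 0 < t → s + t ≤ 1 → ∀ (m n : ℕ), 0 < m → 0 < n →
      ∀ (X Y K : Matrix (Fin n) (Fin n) ℂ), X.PosDef → Y.PosDef →
      ∀ (Φ : Matrix (Fin m) (Fin m) ℂ →ₗ[ℂ] Matrix (Fin n) (Fin n) ℂ),
        IsSchwarzMap Φ → IsSemiunital Φ → (hsAdjoint Φ 1).PosDef →
        (hsAdjoint Φ K.conjTranspose * (hsAdjoint Φ Y) ^ (-s) *
            hsAdjoint Φ K * (hsAdjoint Φ X) ^ (-t)).trace ≤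
          ((((n : ℝ) / (m : ℝ)) ^ (1 - (s + t)) : ℝ) : ℂ) *
            (K.conjTranspose * Y ^ (-s) * K * X ^ (-t)).trace) ∧
    (∀ (s t : ℝ), 0 ≤ s → 0 ≤ t → s + t ≤ 1 → ∀ (n : ℕ), 0 < n →
      ConvexOn ℝ
        {p : Matrix (Fin n) (Fin n) ℂ × Matrix (Fin n) (Fin n) ℂ × Matrix (Fin n) (Fin n) ℂ |
          p.1.PosDef ∧ p.2.1.PosDef}
        (fun p => (p.2.2.conjTranspose * p.2.1 ^ (-s) * p.2.2 * p.1 ^ (-t)).trace)) :=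
  ⟨fun _ _ hs ht hst _ _ hm hn _ _ K hX hY _ hΦ hΦ' h1 =>
    hΦ.trace_hsAdjoint_rpow_le hΦ' hm hn h1 hX hY K hs.le ht.le hst,
  fun _ _ hs ht hst _ _ => convexOn_trace_conjTranspose_mul_rpow_mul_rpow hs ht hst⟩
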